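/- For a group $G$ of homeomorphisms of a topological space $\mathcal{X}$ and $x\in\mathcal{X}$, let $\mathrm{St}_G(x)$ be the subgroup of all $g\in G$ with $g(x)=x$, and let $\mathrm{St}_G^0(x)$ (the neighbourhood stabiliser of $x$) be the subgroup of all $g\in G$ that fix every point of some open neighbourhood of $x$. Let $F$ be Thompson's group acting on $(0,1)$: the group of all piecewise linear homeomorphisms of $(0,1)$ with finitely many breakpoints, all at dyadic rationals, and with all slopes in $\{2^k : k\in\mathbb{Z}\}$. Let $T$ be Thompson's group acting on the circle $S^1=\mathbb{R}/\mathbb{Z}$: the group of all piecewise linear homeomorphisms of $S^1$ that map images of dyadic rationals to images of dyadic rationals, with finitely many breakpoints, all at images of dyadic rationals, and with all slopes in $\{2^k : k\in\mathbb{Z}\}$. Let $V$ be Thompson's group acting on the Cantor space $\{0,1\}^{\mathbb{N}}$: the group of all homeomorphisms of $\{0,1\}^{\mathbb{N}}$ that are locally given by replacing a finite prefix by a finite prefix, i.e. every point has a finite prefix $u$ for which there is a finite word $v$ such that $uz\mapsto vz$ for all $z\in\{0,1\}^{\mathbb{N}}$. **Corollary.** Let $(G,\mathcal{X})$ be one of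 $(F,(0,1))$, $(T,S^1)$, $(V,\{0,1\}^{\mathbb{N}})$. Then for all $x,y\in\mathcal{X}$ there exists a homeomorphism $f\colon\mathcal{X}\to\mathcal{X}$ such that $f\,\mathrm{St}_G^0(x)\,f^{-1}=\mathrm{St}_G^0(y)$. In particular, if $x,y\in(0,1)$ are irrational, then $\mathrm{St}_F(x)$ and $\mathrm{St}_F(y)$ are isomorphic. -/

import Mathlib

open Set Filter Topology

/-! ### Stabilisers in groups of homeomorphisms -/

/-- The stabiliser `St_G(x)` of a point in a group `G` of homeomorphisms of `X`. -/
def pointStabilizer {X : Type*} [TopologicalSpace X] (G : Subgroup (X ≃ₜ X)) (x : X) :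
    Subgroup (X ≃ₜ X) where
  carrier := {g | g ∈ G ∧ g x = x}
  one_mem' := ⟨G.one_mem, rfl⟩
  mul_mem' := by
    rintro a b ⟨ha, hax⟩ ⟨hb, hbx⟩
    refine ⟨G.mul_mem ha hb, ?_⟩
    change a (b x) = x
    rw [hbx, hax]
  inv_mem' := by
    rintro a ⟨ha, hax⟩
    exact ⟨G.inv_mem ha, (Homeomorph.symm_apply_eq a).2 hax.symm⟩

/-- The neighbourhood stabiliser `St_G^0(x)`: the elements of `G` that fix pointwise an open
neighbourhood of `x` (and hence fix `x`). -/
def nbhdStabilizer {X : Type*} [TopologicalSpace X] (G : Subgroup (X ≃ₜ X)) (x : X) :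
    Subgroup (X ≃ₜ X) where
  carrier := {g | g ∈ G ∧ ∃ U : Set X, IsOpen U ∧ x ∈ U ∧ ∀ z ∈ U, g z = z}
  one_mem' := ⟨G.one_mem, univ, isOpen_univ, mem_univ x, fun _ _ => rfl⟩
  mul_mem' := by
    rintro a b ⟨ha, U, hU, hxU, haU⟩ ⟨hb, W, hW, hxW, hbW⟩
    refine ⟨G.mul_mem ha hb, U ∩ W, hU.inter hW, ⟨hxU, hxW⟩, fun z hz => ?_⟩
    change a (b z) = z
    rw [hbW z hz.2, haU z hz.1]
  inv_mem' := by
    rintro a ⟨ha, U, hU, hxU, haU⟩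
    exact ⟨G.inv_mem ha, U, hU, hxU, fun z hz => (Homeomorph.symm_apply_eq a).2 (haU z hz).symm⟩

/-! ### Dyadic rationals -/

/-- The real number `t` is a dyadic rational. -/
def IsDyadic (t : ℝ) : Prop := ∃ (m : ℤ) (n : ℕ), t = m / 2 ^ n

theorem IsDyadic.add {s t : ℝ} (hs : IsDyadic s) (ht : IsDyadic t) : IsDyadic (s + t) := by
  obtain ⟨m, n, rfl⟩ := hs
  obtain ⟨m', n', rfl⟩ := ht
  refine ⟨m * 2 ^ n' + m' * 2 ^ n, n + n', ?_⟩
  push_cast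
  field_simp
  ring

theorem IsDyadic.neg {s : ℝ} (hs : IsDyadic s) : IsDyadic (-s) := by
  obtain ⟨m, n, rfl⟩ := hs
  exact ⟨-m, n, by push_cast; ring⟩

theorem IsDyadic.sub {s t : ℝ} (hs : IsDyadic s) (ht : IsDyadic t) : IsDyadic (s - t) := by
  rw [sub_eq_add_neg]
  exact hs.add ht.neg

theorem IsDyadic.intCast (m : ℤ) : IsDyadic (m : ℝ) := ⟨m, 0, by simp⟩

theorem IsDyadic.zpow_mul {s : ℝ} (hs : IsDyadic s) (k : ℤ) : IsDyadic ((2 : ℝ) ^ k * s) := by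
  obtain ⟨m, n, rfl⟩ := hs
  obtain ⟨j, rfl | rfl⟩ := k.eq_nat_or_neg
  · refine ⟨2 ^ j * m, n, ?_⟩
    push_cast
    rw [zpow_natCast]
    ring
  · refine ⟨m, n + j, ?_⟩
    rw [zpow_neg, zpow_natCast, pow_add]
    field_simp

theorem IsDyadic.of_zpow_mul {s : ℝ} {k : ℤ} (hs : IsDyadic ((2 : ℝ) ^ k * s)) : IsDyadic s := by
  have h := hs.zpow_mul (-k)
  rwa [← mul_assoc, ← zpow_add₀ (two_ne_zero), neg_add_cancel, zpow_zero, one_mul] at h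

theorem exists_isDyadic_btwn {a b : ℝ} (h : a < b) : ∃ t, IsDyadic t ∧ a < t ∧ t < b := by
  obtain ⟨n, hn⟩ := exists_nat_gt (1 / (b - a))
  have hba : 0 < b - a := sub_pos.2 h
  have h2 : (n : ℝ) < 2 ^ n := by exact_mod_cast n.lt_two_pow_self
  have hp : (0 : ℝ) < 2 ^ n := by positivity
  have h3 : 1 < 2 ^ n * (b - a) := by
    rw [div_lt_iff₀ hba] at hn
    nlinarith
  refine ⟨((⌊a * 2 ^ n⌋ + 1 : ℤ) : ℝ) / 2 ^ n, ⟨_, n, rfl⟩, ?_, ?_⟩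
  · rw [lt_div_iff₀ hp]
    push_cast
    exact Int.lt_floor_add_one _
  · rw [div_lt_iff₀ hp]
    push_cast
    have := Int.floor_le (a * 2 ^ n)
    nlinarith

/-! ### Thompson's group `F` -/

/-- The open unit interval `(0,1)`. -/
abbrev UnitOpenInterval : Type := Ioo (0 : ℝ) 1

/-- `f` is a piecewise linear homeomorphism of `(0,1)`, with finitely many breakpoints, all of them
dyadic rationals, and with all slopes integral powers of `2`. As the slopes are positive, such an
`f` extends uniquely to a homeomorphism of `[0,1]` fixing `0` and `1`. -/
def IsThompsonF (f : UnitOpenInterval ≃ₜ UnitOpenInterval) : Prop :=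
  ∃ S : Set ℝ, S.Finite ∧ (∀ s ∈ S, IsDyadic s) ∧
    ∀ t : UnitOpenInterval, (t : ℝ) ∉ S →
      ∃ (k : ℤ) (c : ℝ), ∀ᶠ u in 𝓝 t, (f u : ℝ) = 2 ^ k * (u : ℝ) + c

theorem affine_unique {a b c d : ℝ} {k l : ℤ} (hab : a ≠ b)
    (h1 : (2 : ℝ) ^ k * a + c = 2 ^ l * a + d) (h2 : (2 : ℝ) ^ k * b + c = 2 ^ l * b + d) :
    k = l ∧ c = d := by
  have h3 : ((2 : ℝ) ^ k - 2 ^ l) * (a - b) = 0 := by linear_combination h1 - h2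
  have h4 : (2 : ℝ) ^ k = 2 ^ l := by
    rcases mul_eq_zero.1 h3 with h | h
    · linarith
    · exact absurd (sub_eq_zero.1 h) hab
  exact ⟨zpow_right_injective₀ (by norm_num) (by norm_num) h4, by rw [h4] at h1; linarith⟩

/-- A function that is locally affine with slopes powers of `2` on an interval is affine there. -/
theorem affine_of_locally {a b : ℝ} (hab : a < b) (g : ℝ → ℝ)
    (h : ∀ t ∈ Ioo a b, ∃ (k : ℤ) (c : ℝ), ∀ᶠ u in 𝓝 t, g u = 2 ^ k * u + c) :
    ∃ (k : ℤ) (c : ℝ), ∀ t ∈ Ioo a b, g t = 2 ^ k * t + c := by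
  choose! k c hkc using h
  have key : ∀ x ∈ Ioo a b, ∀ y ∈ Ioo a b, k x = k y ∧ c x = c y := by
    intro x hx y hy
    refine isPreconnected_Ioo.induction₂ (fun x y => k x = k y ∧ c x = c y) ?_ ?_ ?_ hx hy
    · intro x hx
      refine Filter.Eventually.filter_mono nhdsWithin_le_nhds ?_
      filter_upwards [(hkc x hx).eventually_nhds, isOpen_Ioo.mem_nhds hx] with y hy hyI
      have h1 := hy.and (hkc y hyI)
      obtain ⟨e, he, hball⟩ := Metric.eventually_nhds_iff.1 h1
      have p := @hball y (by simpa using he)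
      have q := @hball (y + e / 2) (by
        rw [Real.dist_eq, add_sub_cancel_left, abs_of_pos (by positivity)]; linarith)
      exact affine_unique (a := y) (b := y + e / 2) (by linarith)
        (p.1.symm.trans p.2) (q.1.symm.trans q.2)
    · rintro x y z _ _ _ ⟨h1, h2⟩ ⟨h3, h4⟩
      exact ⟨h1.trans h3, h2.trans h4⟩
    · rintro x y _ _ ⟨h1, h2⟩
      exact ⟨h1.symm, h2.symm⟩
  have hm : (a + b) / 2 ∈ Ioo a b := ⟨by linarith, by linarith⟩
  refine ⟨k ((a + b) / 2), c ((a + b) / 2), fun t ht => ?_⟩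
  obtain ⟨h1, h2⟩ := key t ht _ hm
  rw [← h1, ← h2]
  exact (hkc t ht).self_of_nhds

/-- Elements of `F` map dyadic rationals to dyadic rationals. -/
theorem IsThompsonF.map_isDyadic {f : UnitOpenInterval ≃ₜ UnitOpenInterval} (hf : IsThompsonF f)
    (t : UnitOpenInterval) (ht : IsDyadic (t : ℝ)) : IsDyadic (f t : ℝ) := by
  classical
  obtain ⟨S, hS, hSd, hloc⟩ := hf
  -- the function `f`, extended by zero
  let g : ℝ → ℝ := fun u => if hu : u ∈ Ioo (0 : ℝ) 1 then (f ⟨u, hu⟩ : ℝ) else 0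
  have hg : ∀ u : UnitOpenInterval, g u = f u := fun u => by
    simp only [g, dif_pos u.2]
  have hgc : ContinuousOn g (Ioo 0 1) := by
    rw [continuousOn_iff_continuous_domRestrict]
    have : (Ioo (0 : ℝ) 1).domRestrict g = fun u => (f u : ℝ) := funext hg
    rw [this]
    exact continuous_subtype_val.comp f.continuous
  have hginj : InjOn g (Ioo 0 1) := by
    intro u hu v hv huv
    have h1 := hg ⟨u, hu⟩
    have h2 := hg ⟨v, hv⟩
    have h3 : f ⟨u, hu⟩ = f ⟨v, hv⟩ := Subtype.ext (h1.symm.trans (huv.trans h2))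
    exact congrArg Subtype.val (f.injective h3)
  have hgaff : ∀ t ∈ Ioo (0 : ℝ) 1, t ∉ S →
      ∃ (k : ℤ) (c : ℝ), ∀ᶠ u in 𝓝 t, g u = 2 ^ k * u + c := by
    intro t ht htS
    obtain ⟨k, c, h⟩ := hloc ⟨t, ht⟩ htS
    refine ⟨k, c, ?_⟩
    rw [← map_nhds_subtype_coe_eq_nhds ht (isOpen_Ioo.mem_nhds ht), eventually_map]
    filter_upwards [h] with u hu
    rw [hg, hu]
  -- on an interval that avoids `S` the affine formula also holds at the right end point
  have hpiece : ∀ a b : ℝ, 0 ≤ a → a < b → b < 1 → (∀ s ∈ S, s ∉ Ioo a b) →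
      ∃ (k : ℤ) (c : ℝ), (∀ u ∈ Ioc a b, g u = 2 ^ k * u + c) ∧
        (0 < a → g a = 2 ^ k * a + c) := by
    intro a b ha hab hb hs
    obtain ⟨k, c, h⟩ := affine_of_locally hab g (fun t ht =>
      hgaff t ⟨ha.trans_lt ht.1, ht.2.trans hb⟩ (fun h => hs t h ht))
    have haff : Continuous fun u : ℝ => (2 : ℝ) ^ k * u + c := by fun_prop
    have lim : ∀ p ∈ Ioo (0 : ℝ) 1, p ∈ closure (Ioo a b) → g p = 2 ^ k * p + c := by
      intro p hp hpc
      have : (𝓝[Ioo a b] p).NeBot := mem_closure_iff_nhdsWithin_neBot.1 hpc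
      have h1 : Tendsto g (𝓝[Ioo a b] p) (𝓝 (g p)) :=
        ((hgc.continuousAt (isOpen_Ioo.mem_nhds hp)).tendsto).mono_left nhdsWithin_le_nhds
      have h2 : Tendsto g (𝓝[Ioo a b] p) (𝓝 (2 ^ k * p + c)) := by
        refine ((haff.tendsto p).mono_left nhdsWithin_le_nhds).congr' ?_
        filter_upwards [self_mem_nhdsWithin] with u hu
        exact (h u hu).symm
      exact tendsto_nhds_unique h1 h2
    rw [closure_Ioo hab.ne] at lim
    refine ⟨k, c, fun u hu => ?_, fun ha' => ?_⟩
    · exact lim u ⟨ha.trans_lt hu.1, hu.2.trans_lt hb⟩ ⟨hu.1.le, hu.2⟩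
    · exact lim a ⟨ha', hab.trans hb⟩ ⟨le_rfl, hab.le⟩
  -- induction on the number of breakpoints to the left
  have main : ∀ n : ℕ, ∀ t ∈ Ioo (0 : ℝ) 1, IsDyadic t →
      ((hS.toFinset).filter (fun s => s ∈ Ioo 0 t)).card = n → IsDyadic (g t) := by
    intro n
    induction n using Nat.strong_induction_on with
    | _ n ih =>
      intro t ht htd hn
      rcases ((hS.toFinset).filter (fun s => s ∈ Ioo 0 t)).eq_empty_or_nonempty with he | hne
      · obtain ⟨k, c, h, -⟩ := hpiece 0 t le_rfl ht.1 ht.2 (fun s hs hst => by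
          have : s ∈ (hS.toFinset).filter (fun s => s ∈ Ioo 0 t) := by
            simp [hs, hst.1, hst.2]
          rw [he] at this
          simp at this)
        have hk : (0 : ℝ) < 2 ^ k := by positivity
        have hval : ∀ u ∈ Ioo (0 : ℝ) 1, g u ∈ Ioo (0 : ℝ) 1 := fun u hu => by
          have := hg ⟨u, hu⟩
          rw [this]
          exact (f ⟨u, hu⟩).2
        have hgt := h t ⟨ht.1, le_rfl⟩
        have hc0 : c = 0 := by
          rcases lt_trichotomy c 0 with hc | hc | hc
          · exfalso
            have hu : 0 < min t (-c / 2 ^ k) := lt_min ht.1 (by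
              apply div_pos <;> linarith)
            have h1 := h _ ⟨hu, min_le_left _ _⟩
            have h2 := (hval _ ⟨hu, (min_le_left _ _).trans_lt ht.2⟩).1
            have h3 : 2 ^ k * min t (-c / 2 ^ k) ≤ -c := by
              calc 2 ^ k * min t (-c / 2 ^ k) ≤ 2 ^ k * (-c / 2 ^ k) :=
                    mul_le_mul_of_nonneg_left (min_le_right _ _) hk.le
                _ = -c := by field_simp
            linarith
          · exact hc
          · exfalso
            have hc1 : c < 1 := by
              have h1 := (hval t ht).2
              have h2 : 0 < 2 ^ k * t := mul_pos hk ht.1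
              linarith
            obtain ⟨v, hv⟩ := f.surjective ⟨c / 2, by linarith, by linarith⟩
            have hgv : g v = c / 2 := by rw [hg, hv]
            have htv : t < v := by
              by_contra hle
              have h1 := h v ⟨v.2.1, not_lt.1 hle⟩
              have h2 : 0 < 2 ^ k * (v : ℝ) := mul_pos hk v.2.1
              linarith
            have h2t : t / 2 ∈ Ioo (0 : ℝ) 1 := ⟨by linarith [ht.1], by linarith [ht.1, ht.2]⟩
            have hmid := h (t / 2) ⟨h2t.1, by linarith [ht.1]⟩
            have hpos : 0 < 2 ^ k * (t / 2) := mul_pos hk h2t.1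
            have hsub : Icc t (v : ℝ) ⊆ Ioo 0 1 := fun w hw =>
              ⟨ht.1.trans_le hw.1, hw.2.trans_lt v.2.2⟩
            have himg := intermediate_value_Icc' htv.le (hgc.mono hsub)
            obtain ⟨w, hw, hwe⟩ := himg (show g (t / 2) ∈ Icc (g v) (g t) from
              ⟨by linarith, by rw [hgt, hmid]; linarith⟩)
            have := hginj (hsub hw) h2t hwe
            linarith [hw.1, ht.1]
        rw [hgt, hc0, add_zero]
        exact htd.zpow_mul k
      · set A := (hS.toFinset).filter (fun s => s ∈ Ioo 0 t) with hA
        have hsA := A.max'_mem hne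
        set s := A.max' hne with hs
        have hs' : s ∈ S ∧ 0 < s ∧ s < t := by
          rw [hA] at hsA
          simpa using hsA
        have hsI : s ∈ Ioo (0 : ℝ) 1 := ⟨hs'.2.1, hs'.2.2.trans ht.2⟩
        have hcard : ((hS.toFinset).filter (fun r => r ∈ Ioo 0 s)).card < n := by
          rw [← hn]
          refine Finset.card_lt_card (Finset.ssubset_iff_of_subset ?_ |>.2 ⟨s, hsA, by simp⟩)
          intro r hr
          simp only [hA, Finset.mem_filter, mem_Ioo] at hr ⊢
          exact ⟨hr.1, hr.2.1, hr.2.2.trans hs'.2.2⟩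
        have hgs := ih _ hcard s hsI (hSd s hs'.1) rfl
        obtain ⟨k, c, h, h'⟩ := hpiece s t hs'.2.1.le hs'.2.2 ht.2 (fun r hr hrt => by
          have : r ∈ A := by
            simp only [hA, Finset.mem_filter, mem_Ioo, Finite.mem_toFinset]
            exact ⟨hr, hs'.2.1.trans hrt.1, hrt.2⟩
          exact absurd (A.le_max' r this) (not_le.2 hrt.1))
        have hcd : IsDyadic c := by
          have h1 := hgs.sub ((hSd s hs'.1).zpow_mul k)
          rwa [h' hs'.2.1, add_sub_cancel_left] at h1
        rw [h t ⟨hs'.2.2, le_rfl⟩]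
        exact (htd.zpow_mul k).add hcd
  rw [← hg]
  exact main _ t t.2 ht rfl

/-- A point whose image under an element of `F` is dyadic is itself dyadic. -/
theorem IsThompsonF.isDyadic_of_map {f : UnitOpenInterval ≃ₜ UnitOpenInterval} (hf : IsThompsonF f)
    (t : UnitOpenInterval) (ht : IsDyadic (f t : ℝ)) : IsDyadic (t : ℝ) := by
  have hmap := hf.map_isDyadic
  obtain ⟨S, -, hSd, hloc⟩ := hf
  by_cases hts : (t : ℝ) ∈ S
  · exact hSd _ hts
  obtain ⟨k, c, h⟩ := hloc t hts
  obtain ⟨e, he, hball⟩ := Metric.eventually_nhds_iff.1 h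
  obtain ⟨u, hud, hu1, hu2⟩ := exists_isDyadic_btwn (lt_min (a := (t : ℝ)) t.2.2
    (show (t : ℝ) < t + e by linarith))
  have huI : u ∈ Ioo (0 : ℝ) 1 := ⟨t.2.1.trans hu1, hu2.trans_le (min_le_left _ _)⟩
  have hue := @hball ⟨u, huI⟩ (by
    rw [Subtype.dist_eq, Real.dist_eq, abs_of_pos (by linarith)]
    linarith [hu2.trans_le (min_le_right _ _)])
  have hd := hmap ⟨u, huI⟩ hud
  rw [hue] at hd
  have hcd : IsDyadic c := by
    have h1 := hd.sub (hud.zpow_mul k)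
    rwa [add_sub_cancel_left] at h1
  rw [h.self_of_nhds] at ht
  have h2 := ht.sub hcd
  rw [add_sub_cancel_right] at h2
  exact h2.of_zpow_mul

/-- Thompson's group `F`, as a group of homeomorphisms of `(0,1)`. -/
def thompsonF : Subgroup (UnitOpenInterval ≃ₜ UnitOpenInterval) where
  carrier := {f | IsThompsonF f}
  one_mem' := ⟨∅, finite_empty, by simp, fun t _ => ⟨0, 0, Eventually.of_forall fun u => by
    simp⟩⟩
  mul_mem' := by
    intro f g hf hg
    have hgd := hg.isDyadic_of_map
    obtain ⟨S, hS, hSd, hSl⟩ := hf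
    obtain ⟨R, hR, hRd, hRl⟩ := hg
    refine ⟨R ∪ (fun u : UnitOpenInterval => (u : ℝ)) '' {u | (g u : ℝ) ∈ S}, ?_, ?_, ?_⟩
    · exact hR.union ((hS.preimage
        ((Subtype.val_injective.comp g.injective).injOn)).image _)
    · rintro s (hs | ⟨u, hu, rfl⟩)
      · exact hRd s hs
      · exact hgd u (hSd _ hu)
    · intro t ht
      obtain ⟨k, c, h⟩ := hRl t (fun h => ht (Or.inl h))
      obtain ⟨l, d, h'⟩ := hSl (g t) (fun h => ht (Or.inr ⟨t, h, rfl⟩))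
      refine ⟨l + k, 2 ^ l * c + d, ?_⟩
      filter_upwards [h, g.continuous.continuousAt.eventually h'] with u hu hu'
      change (f (g u) : ℝ) = _
      rw [hu', hu, zpow_add₀ two_ne_zero]
      ring
  inv_mem' := by
    intro f hf
    have hfd := hf.map_isDyadic
    obtain ⟨S, hS, hSd, hSl⟩ := hf
    refine ⟨(fun u : UnitOpenInterval => (f u : ℝ)) '' {u | (u : ℝ) ∈ S}, ?_, ?_, ?_⟩
    · exact (hS.preimage Subtype.val_injective.injOn).image _
    · rintro s ⟨u, hu, rfl⟩
      exact hfd u (hSd _ hu)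
    · intro t ht
      obtain ⟨k, c, h⟩ := hSl (f.symm t) (fun h => ht ⟨f.symm t, h, by simp⟩)
      refine ⟨-k, -(2 ^ (-k) * c), ?_⟩
      filter_upwards [f.symm.continuous.continuousAt.eventually h] with u hu
      change (f.symm u : ℝ) = _
      rw [f.apply_symm_apply] at hu
      have hk : (2 : ℝ) ^ k ≠ 0 := by positivity
      rw [hu, zpow_neg]
      field_simp
      ring

/-! ### Thompson's group `T` -/

/-- A point of the circle `ℝ / ℤ` is dyadic if it is the image of a dyadic rational. -/
def IsDyadicPoint (p : UnitAddCircle) : Prop := ∃ t : ℝ, IsDyadic t ∧ (t : UnitAddCircle) = p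

theorem circle_coe_eq_iff {s t : ℝ} :
    (s : UnitAddCircle) = (t : UnitAddCircle) ↔ ∃ n : ℤ, (n : ℝ) = s - t := by
  rw [← sub_eq_zero, ← AddCircle.coe_sub, AddCircle.coe_eq_zero_iff]
  simp

theorem isDyadicPoint_coe {t : ℝ} : IsDyadicPoint (t : UnitAddCircle) ↔ IsDyadic t := by
  refine ⟨?_, fun h => ⟨t, h, rfl⟩⟩
  rintro ⟨s, hs, hst⟩
  obtain ⟨n, hn⟩ := circle_coe_eq_iff.1 hst
  have h := hs.sub (IsDyadic.intCast n)
  rwa [hn, sub_sub_cancel] at h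

/-- `f` is a piecewise linear homeomorphism of the circle `ℝ / ℤ` that maps dyadic points to dyadic
points and has finitely many breakpoints, all of them dyadic, and slopes integral powers of `2`. -/
def IsThompsonT (f : UnitAddCircle ≃ₜ UnitAddCircle) : Prop :=
  (∀ p, IsDyadicPoint p → IsDyadicPoint (f p)) ∧
  ∃ S : Set UnitAddCircle, S.Finite ∧ (∀ s ∈ S, IsDyadicPoint s) ∧
    ∀ t : ℝ, (t : UnitAddCircle) ∉ S →
      ∃ (k : ℤ) (c : ℝ), ∀ᶠ u : ℝ in 𝓝 t,
        f (u : UnitAddCircle) = ((2 ^ k * u + c : ℝ) : UnitAddCircle)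

/-- A point whose image under an element of `T` is dyadic is itself dyadic. -/
theorem IsThompsonT.isDyadicPoint_of_map {f : UnitAddCircle ≃ₜ UnitAddCircle}
    (hf : IsThompsonT f) (p : UnitAddCircle) (hp : IsDyadicPoint (f p)) : IsDyadicPoint p := by
  obtain ⟨hmap, S, -, hSd, hloc⟩ := hf
  by_cases hpS : p ∈ S
  · exact hSd _ hpS
  obtain ⟨t, rfl⟩ := QuotientAddGroup.mk_surjective p
  obtain ⟨k, c, h⟩ := hloc t hpS
  obtain ⟨e, he, hball⟩ := Metric.eventually_nhds_iff.1 h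
  obtain ⟨u, hud, hu1, hu2⟩ := exists_isDyadic_btwn (show t < t + e by linarith)
  have hue := @hball u (by rw [Real.dist_eq, abs_of_pos (by linarith)]; linarith)
  have hd := hmap u ⟨u, hud, rfl⟩
  rw [hue, isDyadicPoint_coe] at hd
  have hcd : IsDyadic c := by
    have h1 := hd.sub (hud.zpow_mul k)
    rwa [add_sub_cancel_left] at h1
  have ht := h.self_of_nhds
  change IsDyadicPoint (f (t : UnitAddCircle)) at hp
  rw [ht, isDyadicPoint_coe] at hp
  have h2 := hp.sub hcd
  rw [add_sub_cancel_right] at h2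
  exact ⟨t, h2.of_zpow_mul, rfl⟩

/-- Thompson's group `T`, as a group of homeomorphisms of the circle `ℝ / ℤ`. -/
def thompsonT : Subgroup (UnitAddCircle ≃ₜ UnitAddCircle) where
  carrier := {f | IsThompsonT f}
  one_mem' := ⟨fun _ h => h, ∅, finite_empty, by simp, fun t _ => ⟨0, 0,
    Eventually.of_forall fun u => by simp⟩⟩
  mul_mem' := by
    intro f g hf hg
    have hgd := hg.isDyadicPoint_of_map
    obtain ⟨hfm, S, hS, hSd, hSl⟩ := hf
    obtain ⟨hgm, R, hR, hRd, hRl⟩ := hg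
    refine ⟨fun p hp => hfm _ (hgm p hp), R ∪ g ⁻¹' S,
      hR.union (hS.preimage g.injective.injOn), ?_, ?_⟩
    · rintro s (hs | hs)
      · exact hRd s hs
      · exact hgd s (hSd _ hs)
    · intro t ht
      obtain ⟨k, c, h⟩ := hRl t (fun h => ht (Or.inl h))
      have hgt := h.self_of_nhds
      obtain ⟨l, d, h'⟩ := hSl (2 ^ k * t + c) (fun h => ht (Or.inr (by
        rw [mem_preimage, hgt]
        exact h)))
      have hc : Continuous fun u : ℝ => (2 : ℝ) ^ k * u + c := by fun_prop
      refine ⟨l + k, 2 ^ l * c + d, ?_⟩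
      filter_upwards [h, hc.continuousAt.eventually h'] with u hu hu'
      change f (g u) = _
      rw [hu, hu', zpow_add₀ two_ne_zero]
      congr 1
      ring
  inv_mem' := by
    intro f hf
    have hfd := hf.isDyadicPoint_of_map
    obtain ⟨hfm, S, hS, hSd, hSl⟩ := hf
    refine ⟨fun p hp => hfd _ (by
      change IsDyadicPoint (f (f.symm p))
      rwa [f.apply_symm_apply]), f '' S, hS.image _, ?_, ?_⟩
    · rintro s ⟨p, hp, rfl⟩
      exact hfm p (hSd p hp)
    · intro y hy
      obtain ⟨t, ht⟩ := QuotientAddGroup.mk_surjective (f.symm (y : UnitAddCircle))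
      change (t : UnitAddCircle) = _ at ht
      have hfy : f (t : UnitAddCircle) = y := by rw [ht, f.apply_symm_apply]
      obtain ⟨k, c, h⟩ := hSl t (fun h => hy ⟨t, h, hfy⟩)
      rw [h.self_of_nhds] at hfy
      obtain ⟨n, hn⟩ := circle_coe_eq_iff.1 hfy
      have hk : (2 : ℝ) ^ k ≠ 0 := by positivity
      have hc : Continuous fun v : ℝ => (2 : ℝ) ^ (-k) * v + 2 ^ (-k) * (n - c) := by fun_prop
      have hcy : (2 : ℝ) ^ (-k) * y + 2 ^ (-k) * (n - c) = t := by
        rw [hn, zpow_neg]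
        field_simp
        ring
      refine ⟨-k, 2 ^ (-k) * (n - c), ?_⟩
      have h2 := hc.tendsto y
      rw [hcy] at h2
      filter_upwards [h2.eventually h] with v hv
      change f.symm v = _
      rw [f.symm_apply_eq, hv]
      refine circle_coe_eq_iff.2 ⟨-n, ?_⟩
      rw [zpow_neg]
      push_cast
      field_simp
      ring

/-! ### Thompson's group `V` -/

/-- The Cantor space of infinite binary words, with the product topology. -/
abbrev CantorSpace : Type := ℕ → Bool

/-- Near every infinite word, `f` replaces a finite prefix by a finite prefix: for each `x` there
are `n` and `m` such that `f` maps each word `x₀ … x_{n-1} z` to `y₀ … y_{m-1} z`, where `y = f x`.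
By compactness, such an `f` is given by a finite table of prefix replacements. -/
def IsThompsonV (f : CantorSpace ≃ₜ CantorSpace) : Prop :=
  ∀ x : CantorSpace, ∃ n m : ℕ, ∀ w : CantorSpace, (∀ i < n, w i = x i) →
    (∀ i < m, f w i = f x i) ∧ ∀ i, f w (m + i) = w (n + i)

/-- Thompson's group `V`, as a group of homeomorphisms of the Cantor space. -/
def thompsonV : Subgroup (CantorSpace ≃ₜ CantorSpace) where
  carrier := {f | IsThompsonV f}
  one_mem' := fun _ => ⟨0, 0, fun _ _ => ⟨by simp, fun _ => rfl⟩⟩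
  mul_mem' := by
    intro f g hf hg x
    obtain ⟨n, m, h⟩ := hg x
    obtain ⟨n', m', h'⟩ := hf (g x)
    have hx := h x (fun _ _ => rfl)
    refine ⟨n + (n' - m), m' + (m - n'), fun w hw => ?_⟩
    obtain ⟨h1, h2⟩ := h w (fun i hi => hw i (by omega))
    have hag : ∀ i < m + (n' - m), g w i = g x i := by
      intro i hi
      by_cases him : i < m
      · exact h1 i him
      · obtain ⟨j, rfl⟩ := Nat.exists_eq_add_of_le (not_lt.1 him)
        rw [h2, hx.2]
        exact hw _ (by omega)
    obtain ⟨h3, h4⟩ := h' (g w) (fun i hi => hag i (by omega))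
    have hx' := h' (g x) (fun _ _ => rfl)
    change (∀ i < _, f (g w) i = f (g x) i) ∧ ∀ i, f (g w) _ = _
    refine ⟨fun i hi => ?_, fun i => ?_⟩
    · by_cases him : i < m'
      · exact h3 i him
      · obtain ⟨j, rfl⟩ := Nat.exists_eq_add_of_le (not_lt.1 him)
        rw [h4, hx'.2]
        exact hag _ (by omega)
    · rw [add_assoc, h4, show n' + (m - n' + i) = m + (n' - m + i) by omega, h2, add_assoc]
  inv_mem' := by
    intro f hf y
    obtain ⟨n, m, h⟩ := hf (f.symm y)
    rw [f.apply_symm_apply] at h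
    refine ⟨m, n, fun w hw => ?_⟩
    change (∀ i < n, f.symm w i = f.symm y i) ∧ ∀ i, f.symm w _ = _
    let v : CantorSpace := fun i => if i < n then f.symm y i else w (m + (i - n))
    have hv : f v = w := by
      obtain ⟨h1, h2⟩ := h v (fun i hi => by simp [v, hi])
      funext i
      by_cases him : i < m
      · rw [h1 i him, hw i him]
      · obtain ⟨j, rfl⟩ := Nat.exists_eq_add_of_le (not_lt.1 him)
        rw [h2]
        simp [v]
    have hv' : f.symm w = v := (f.symm_apply_eq).2 hv.symm
    rw [hv']
    exact ⟨fun i hi => by simp [v, hi], fun i => by simp [v]⟩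

/-!
Call a homeomorphism `f` of `X` a limit of elements of `G` away from `x` if outside each
neighbourhood of `x` it agrees with some element of `G` (`AgreesAwayFrom`). Such an `f` conjugates
`St_G^0(x)` onto `St_G^0(f x)`: if `h` is trivial on a neighbourhood `U` of `x` and `g ∈ G` agrees
with `f` outside `U`, then `f h f⁻¹ = g h g⁻¹ ∈ G`
(`AgreesAwayFrom.map_conj_nbhdStabilizer`). It remains to find, for all `x` and `y`, such an `f`
with `f x = y`.

For `F`, choose dyadic intervals `[a n, b n]` shrinking to `x` and `[c n, d n]` shrinking to `y`.
Any two dyadic intervals are related by a dyadic piecewise linear map (`exists_isDyadicPL`), so there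
are `g n ∈ F` that map `[a n, b n]` onto `[c n, d n]`, where `g (n + 1)` differs from `g n` only inside
`[a n, b n]`. The pointwise limit of the `g n` is the required homeomorphism
(`NestedHomeos.exists_homeomorph`).

For `T`, the circle is the one-point compactification of `(0,1)`, and the extension of homeomorphisms
by `0 ↦ 0` maps `F` into `T`; this handles the nonzero points, and a rotation by one half the rest.

For `V`, the map that replaces the prefix `x₀ … x_{n-1}` by `y₀ … y_{n-1}`, and the first digit
different from that of `x` by the digit different from that of `y`, is explicit (`prefixSwap`).

Finally, an element of `F` that fixes an irrational point is the identity near that point, so that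
`St_F(x) = St_F^0(x)` for irrational `x` (`pointStabilizer_thompsonF_eq`).
-/

/-! ### Limits of group elements away from a point -/

/-- `f` coincides with an element of `G` outside each neighbourhood of `x`; the element may depend
on the neighbourhood. -/
def AgreesAwayFrom {X : Type*} [TopologicalSpace X] (G : Subgroup (X ≃ₜ X)) (f : X ≃ₜ X)
    (x : X) : Prop :=
  ∀ U ∈ 𝓝 x, ∃ g ∈ G, EqOn f g Uᶜ

namespace AgreesAwayFrom

variable {X : Type*} [TopologicalSpace X] {G : Subgroup (X ≃ₜ X)} {f f' : X ≃ₜ X} {x : X}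

theorem of_mem (hf : f ∈ G) (x : X) : AgreesAwayFrom G f x :=
  fun _ _ => ⟨f, hf, fun _ _ => rfl⟩

theorem symm (h : AgreesAwayFrom G f x) : AgreesAwayFrom G f.symm (f x) := by
  intro U hU
  obtain ⟨g, hg, hfg⟩ := h (f ⁻¹' U) (f.continuous.continuousAt.preimage_mem_nhds hU)
  refine ⟨g⁻¹, G.inv_mem hg, fun p hp => ?_⟩
  change f.symm p = g.symm p
  have h1 : f (f.symm p) = g (f.symm p) := hfg (by simpa using hp)
  rw [g.eq_symm_apply, ← h1, f.apply_symm_apply]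

theorem trans (h : AgreesAwayFrom G f x) (h' : AgreesAwayFrom G f' (f x)) :
    AgreesAwayFrom G (f.trans f') x := by
  intro U hU
  obtain ⟨g, hg, hfg⟩ := h U hU
  obtain ⟨g', hg', hfg'⟩ := h' (f '' U) (f.isOpenMap.image_mem_nhds hU)
  refine ⟨g' * g, G.mul_mem hg' hg, fun z hz => ?_⟩
  change f' (f z) = g' (g z)
  rw [← hfg hz]
  exact hfg' (by rwa [mem_compl_iff, f.injective.mem_set_image])

/-- If `h` is trivial on `U` and `f` agrees with `g ∈ G` outside `U`, then `f` and `g` conjugate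
`h` to the same homeomorphism. -/
theorem conj_mem_nbhdStabilizer (hf : AgreesAwayFrom G f x) {h : X ≃ₜ X}
    (hh : h ∈ nbhdStabilizer G x) : f * h * f⁻¹ ∈ nbhdStabilizer G (f x) := by
  obtain ⟨hG, U, hU, hxU, hfix⟩ := hh
  obtain ⟨g, hg, hfg⟩ := hf U (hU.mem_nhds hxU)
  have hout : ∀ z ∉ U, h z ∉ U := fun z hz hz' => hz (by
    have := h.injective (hfix _ hz')
    rwa [this] at hz')
  have hconj : f * h * f⁻¹ = g * h * g⁻¹ := by
    ext p
    obtain ⟨z, rfl⟩ := f.surjective p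
    change f (h (f.symm (f z))) = g (h (g.symm (f z)))
    rw [f.symm_apply_apply]
    by_cases hz : z ∈ U
    · -- `f` and `g` have the same image of the complement of `U`, hence of `U`
      have hgz : g.symm (f z) ∈ U := by
        by_contra hn
        have h1 := hfg hn
        rw [g.apply_symm_apply] at h1
        rw [f.injective h1] at hn
        exact hn hz
      rw [hfix _ hz, hfix _ hgz, g.apply_symm_apply]
    · rw [hfg (hout z hz), hfg hz, g.symm_apply_apply]
  refine ⟨?_, f '' U, f.isOpen_image.2 hU, mem_image_of_mem f hxU, ?_⟩
  · rw [hconj]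
    exact G.mul_mem (G.mul_mem hg hG) (G.inv_mem hg)
  · rintro _ ⟨z, hz, rfl⟩
    change f (h (f.symm (f z))) = f z
    rw [f.symm_apply_apply, hfix z hz]

theorem map_conj_nbhdStabilizer (hf : AgreesAwayFrom G f x) :
    (nbhdStabilizer G x).map (MulAut.conj f).toMonoidHom = nbhdStabilizer G (f x) := by
  refine le_antisymm ?_ fun h hh => ?_
  · rintro _ ⟨h, hh, rfl⟩
    exact hf.conj_mem_nbhdStabilizer hh
  · have h1 := hf.symm.conj_mem_nbhdStabilizer hh
    rw [f.symm_apply_apply] at h1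
    refine ⟨_, h1, ?_⟩
    change f * (f⁻¹ * h * f⁻¹⁻¹) * f⁻¹ = h
    group

end AgreesAwayFrom

/-! ### Homeomorphisms from sequences that stabilise away from a point -/

/-- Closed neighbourhoods `U n` shrinking to `x` and `W n` shrinking to `y`, with homeomorphisms
`g n` that carry `U n` onto `W n` and of which `g (n + 1)` modifies `g n` only inside `U n`. -/
structure NestedHomeos {X : Type*} [TopologicalSpace X] (U W : ℕ → Set X) (g : ℕ → X ≃ₜ X)
    (x y : X) : Prop where
  basis_left : (𝓝 x).HasAntitoneBasis U
  basis_right : (𝓝 y).HasAntitoneBasis W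
  isClosed_left : ∀ n, IsClosed (U n)
  isClosed_right : ∀ n, IsClosed (W n)
  mem_iff : ∀ n z, g n z ∈ W n ↔ z ∈ U n
  eqOn_succ : ∀ n, EqOn (g (n + 1)) (g n) (U n)ᶜ

namespace NestedHomeos

variable {X : Type*} [TopologicalSpace X] {U W : ℕ → Set X} {g : ℕ → X ≃ₜ X} {x y : X}

theorem symm (h : NestedHomeos U W g x y) :
    NestedHomeos W U (fun n => (g n).symm) y x where
  basis_left := h.basis_right
  basis_right := h.basis_left
  isClosed_left := h.isClosed_right
  isClosed_right := h.isClosed_left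
  mem_iff n z := by rw [← h.mem_iff, (g n).apply_symm_apply]
  eqOn_succ n p hp := by
    have h1 : (g n).symm p ∉ U n := by rwa [← h.mem_iff, (g n).apply_symm_apply]
    have h2 := h.eqOn_succ n h1
    rw [(g n).apply_symm_apply] at h2
    exact ((g (n + 1)).symm_apply_eq).2 h2.symm

theorem eqOn_of_le (h : NestedHomeos U W g x y) {n m : ℕ} (hnm : n ≤ m) :
    EqOn (g m) (g n) (U n)ᶜ := by
  induction m, hnm using Nat.le_induction with
  | base => exact fun _ _ => rfl
  | succ m hnm ih =>
    intro z hz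
    rw [h.eqOn_succ m (fun hm => hz (h.basis_left.antitone hnm hm)), ih hz]

theorem mem_of_le (h : NestedHomeos U W g x y) {n m : ℕ} (hnm : n ≤ m) {z : X} (hz : z ∈ U n) :
    g m z ∈ W n := by
  by_contra hn
  have h1 : (g n).symm (g m z) ∉ U n := by rwa [← h.mem_iff, (g n).apply_symm_apply]
  have h2 := h.eqOn_of_le hnm h1
  rw [(g n).apply_symm_apply] at h2
  rw [(g m).injective h2] at h1
  exact h1 hz

theorem exists_notMem [T1Space X] (h : NestedHomeos U W g x y) {z : X} (hz : z ≠ x) :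
    ∃ n, z ∉ U n := by
  obtain ⟨n, -, hn⟩ := h.basis_left.toHasBasis.mem_iff.1 (isOpen_ne.mem_nhds hz.symm)
  exact ⟨n, fun h => hn h rfl⟩

open Classical in
/-- The pointwise limit of the homeomorphisms `g n`, with the value `y` on the intersection of the
sets `U n`. -/
noncomputable def limitFun (U : ℕ → Set X) (g : ℕ → X ≃ₜ X) (y : X) (z : X) : X :=
  if h : ∃ n, z ∉ U n then g (Nat.find h) z else y

theorem limitFun_eqOn (h : NestedHomeos U W g x y) (n : ℕ) : EqOn (limitFun U g y) (g n) (U n)ᶜ := by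
  classical
  intro z hz
  have hex : ∃ n, z ∉ U n := ⟨n, hz⟩
  rw [limitFun, dif_pos hex]
  exact (h.eqOn_of_le (Nat.find_min' hex hz) (Nat.find_spec hex)).symm

theorem limitFun_self (h : NestedHomeos U W g x y) : limitFun U g y x = y := by
  rw [limitFun, dif_neg]
  rintro ⟨n, hn⟩
  exact hn (mem_of_mem_nhds (h.basis_left.toHasBasis.mem_of_mem trivial))

theorem limitFun_mem [T1Space X] (h : NestedHomeos U W g x y) {n : ℕ} {z : X} (hz : z ∈ U n) :
    limitFun U g y z ∈ W n := by
  by_cases hzx : z = x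
  · rw [hzx, h.limitFun_self]
    exact mem_of_mem_nhds (h.basis_right.toHasBasis.mem_of_mem trivial)
  · obtain ⟨m, hm⟩ := h.exists_notMem hzx
    have hnm : n ≤ m := by
      by_contra hlt
      exact hm (h.basis_left.antitone (not_le.1 hlt).le hz)
    rw [h.limitFun_eqOn m hm]
    exact h.mem_of_le hnm hz

theorem continuous_limitFun [T1Space X] (h : NestedHomeos U W g x y) :
    Continuous (limitFun U g y) := by
  rw [continuous_iff_continuousAt]
  intro z
  by_cases hzx : z = x
  · rw [hzx, ContinuousAt, h.limitFun_self,
      h.basis_left.toHasBasis.tendsto_iff h.basis_right.toHasBasis]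
    exact fun n _ => ⟨n, trivial, fun z hz => h.limitFun_mem hz⟩
  · obtain ⟨n, hn⟩ := h.exists_notMem hzx
    exact (g n).continuous.continuousAt.congr
      ((h.limitFun_eqOn n).symm.eventuallyEq_of_mem ((h.isClosed_left n).isOpen_compl.mem_nhds hn))

theorem leftInverse_limitFun [T1Space X] (h : NestedHomeos U W g x y) :
    Function.LeftInverse (limitFun W (fun n => (g n).symm) x) (limitFun U g y) := by
  intro z
  by_cases hzx : z = x
  · rw [hzx, h.limitFun_self, h.symm.limitFun_self]
  · obtain ⟨n, hn⟩ := h.exists_notMem hzx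
    rw [h.limitFun_eqOn n hn, h.symm.limitFun_eqOn n (fun hm => hn ((h.mem_iff n z).1 hm)),
      (g n).symm_apply_apply]

theorem exists_homeomorph [T1Space X] (h : NestedHomeos U W g x y) {G : Subgroup (X ≃ₜ X)}
    (hg : ∀ n, g n ∈ G) : ∃ f : X ≃ₜ X, f x = y ∧ AgreesAwayFrom G f x := by
  refine ⟨{ toFun := limitFun U g y
            invFun := limitFun W (fun n => (g n).symm) x
            left_inv := h.leftInverse_limitFun
            right_inv := h.symm.leftInverse_limitFun
            continuous_toFun := h.continuous_limitFun
            continuous_invFun := h.symm.continuous_limitFun }, h.limitFun_self, fun V hV => ?_⟩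
  obtain ⟨n, -, hn⟩ := h.basis_left.toHasBasis.mem_iff.1 hV
  exact ⟨g n, hg n, fun z hz => h.limitFun_eqOn n (fun hm => hz (hn hm))⟩

end NestedHomeos

/-! ### The Cantor space -/

open Classical in
/-- Adds `x i + y i` modulo `2` to each digit `w i` up to and including the first one that differs
from `x i`: the common prefix of `w` and `x` becomes a prefix of `y`, and the first digit different
from that of `x` becomes the digit different from that of `y`. -/
noncomputable def prefixSwap (x y w : CantorSpace) : CantorSpace :=
  fun i => if ∀ j < i, w j = x j then w i ^^ (x i ^^ y i) else w i

theorem prefixSwap_eq_iff (x y w : CantorSpace) (i : ℕ) :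
    (∀ j < i, prefixSwap x y w j = y j) ↔ ∀ j < i, w j = x j := by
  induction i with
  | zero => simp
  | succ i ih =>
    rw [Nat.forall_lt_succ_right, Nat.forall_lt_succ_right, ih]
    refine and_congr_right fun h => ?_
    rw [prefixSwap, if_pos h]
    cases w i <;> cases x i <;> cases y i <;> decide

theorem prefixSwap_prefixSwap (x y w : CantorSpace) :
    prefixSwap y x (prefixSwap x y w) = w := by
  funext i
  rw [prefixSwap]
  simp only [prefixSwap_eq_iff]
  split_ifs with h
  · rw [prefixSwap, if_pos h]
    cases w i <;> cases x i <;> cases y i <;> rfl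
  · rw [prefixSwap, if_neg h]

theorem continuous_prefixSwap (x y : CantorSpace) : Continuous (prefixSwap x y) := by
  classical
  refine continuous_pi fun i => IsLocallyConstant.continuous ?_
  rw [IsLocallyConstant.iff_eventually_eq]
  intro w
  have h : ∀ᶠ v : CantorSpace in 𝓝 w, ∀ j ∈ Iic i, v j = w j := by
    rw [eventually_all_finite (finite_Iic i)]
    intro j _
    exact (continuous_apply j).continuousAt.eventually
      (show ∀ᶠ b in 𝓝 (w j), b = w j by simp [nhds_discrete])
  filter_upwards [h] with v hv
  have h1 : (∀ j < i, v j = x j) ↔ ∀ j < i, w j = x j :=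
    forall₂_congr fun j hj => by rw [hv j hj.le]
  simp only [prefixSwap, h1, hv i self_mem_Iic]

/-- `prefixSwap x y` as a homeomorphism; its inverse is `prefixSwap y x`. -/
noncomputable def prefixSwapHomeo (x y : CantorSpace) : CantorSpace ≃ₜ CantorSpace where
  toFun := prefixSwap x y
  invFun := prefixSwap y x
  left_inv := prefixSwap_prefixSwap x y
  right_inv := prefixSwap_prefixSwap y x
  continuous_toFun := continuous_prefixSwap x y
  continuous_invFun := continuous_prefixSwap y x

theorem prefixSwapHomeo_self (x y : CantorSpace) : prefixSwapHomeo x y x = y := by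
  funext i
  change prefixSwap x y x i = y i
  rw [prefixSwap, if_pos fun _ _ => rfl]
  cases x i <;> cases y i <;> rfl

theorem prefixSwapHomeo_mem_thompsonV {x y : CantorSpace} {N : ℕ} (h : ∀ i, N ≤ i → y i = x i) :
    prefixSwapHomeo x y ∈ thompsonV := by
  intro z
  refine ⟨N, N, fun w hw => ⟨fun i hi => ?_, fun i => ?_⟩⟩
  · have h1 : (∀ j < i, w j = x j) ↔ ∀ j < i, z j = x j :=
      forall₂_congr fun j hj => by rw [hw j (hj.trans hi)]
    change prefixSwap x y w i = prefixSwap x y z i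
    simp only [prefixSwap, h1, hw i hi]
  · change prefixSwap x y w (N + i) = w (N + i)
    rw [prefixSwap, h (N + i) (Nat.le_add_right _ _)]
    simp

theorem agreesAwayFrom_prefixSwapHomeo (x y : CantorSpace) :
    AgreesAwayFrom thompsonV (prefixSwapHomeo x y) x := by
  intro U hU
  -- `U` contains a cylinder around `x`
  obtain ⟨N, hN⟩ : ∃ N : ℕ, ∀ w : CantorSpace, (∀ i < N, w i = x i) → w ∈ U := by
    rw [nhds_pi, Filter.mem_pi] at hU
    obtain ⟨I, hI, t, ht, htU⟩ := hU
    obtain ⟨M, hM⟩ := hI.bddAbove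
    refine ⟨M + 1, fun w hw => htU fun i hi => ?_⟩
    rw [hw i (Nat.lt_succ_of_le (hM hi))]
    exact mem_of_mem_nhds (ht i)
  refine ⟨prefixSwapHomeo x fun i => if i < N then y i else x i,
    prefixSwapHomeo_mem_thompsonV (N := N) fun i hi => if_neg (not_lt.2 hi), fun w hw => ?_⟩
  obtain ⟨k, hkN, hk⟩ : ∃ k < N, w k ≠ x k := by
    by_contra! hcon
    exact hw (hN w hcon)
  funext i
  change prefixSwap x y w i = prefixSwap x (fun i => if i < N then y i else x i) w i
  rw [prefixSwap, prefixSwap]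
  split_ifs with h1 h2
  · rfl
  · exact absurd (h1 k (by omega)) hk
  · rfl

/-! ### Dyadic piecewise linear maps of the line -/

/-- `φ` is a strictly increasing piecewise linear map of the line, with finitely many breakpoints,
all of them dyadic, and with slopes integral powers of `2`. -/
structure IsDyadicPL (φ : ℝ → ℝ) : Prop where
  continuous : Continuous φ
  strictMono : StrictMono φ
  locally_affine : ∃ S : Set ℝ, S.Finite ∧ (∀ s ∈ S, IsDyadic s) ∧
    ∀ t ∉ S, ∃ (k : ℤ) (c : ℝ), ∀ᶠ u in 𝓝 t, φ u = 2 ^ k * u + c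

theorem isDyadicPL_affine (k : ℤ) (c : ℝ) : IsDyadicPL fun t => 2 ^ k * t + c where
  continuous := by fun_prop
  strictMono s t hst := by
    have : (0 : ℝ) < 2 ^ k := by positivity
    simpa using mul_lt_mul_of_pos_left hst this
  locally_affine := ⟨∅, finite_empty, by simp, fun t _ => ⟨k, c, Eventually.of_forall fun _ => rfl⟩⟩

theorem isDyadicPL_id : IsDyadicPL fun t => t := by
  simpa using isDyadicPL_affine 0 0

/-- The map that is `φ` to the left of `s` and `ψ` to the right of `s`. -/
noncomputable def glueAt (s : ℝ) (φ ψ : ℝ → ℝ) : ℝ → ℝ := fun t => if t ≤ s then φ t else ψ t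

theorem glueAt_of_le {s t : ℝ} {φ ψ : ℝ → ℝ} (h : t ≤ s) : glueAt s φ ψ t = φ t := if_pos h

theorem glueAt_of_ge {s t : ℝ} {φ ψ : ℝ → ℝ} (hs : φ s = ψ s) (h : s ≤ t) : glueAt s φ ψ t = ψ t := by
  rcases h.eq_or_lt with rfl | h
  · rw [glueAt_of_le le_rfl, hs]
  · exact if_neg (not_le.2 h)

theorem IsDyadicPL.glue {φ ψ : ℝ → ℝ} (hφ : IsDyadicPL φ) (hψ : IsDyadicPL ψ) {s : ℝ}
    (hs : IsDyadic s) (h : φ s = ψ s) : IsDyadicPL (glueAt s φ ψ) where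
  continuous := Continuous.if_le hφ.continuous hψ.continuous continuous_id continuous_const
    (by rintro _ rfl; exact h)
  strictMono u v huv := by
    rcases le_total v s with hv | hv
    · rw [glueAt_of_le hv, glueAt_of_le (huv.le.trans hv)]
      exact hφ.strictMono huv
    rcases le_total u s with hu | hu
    · rw [glueAt_of_le hu, glueAt_of_ge h hv]
      rcases hu.eq_or_lt with rfl | hu
      · rw [h]
        exact hψ.strictMono huv
      · exact ((hφ.strictMono hu).trans_eq h).trans_le (hψ.strictMono.monotone hv)
    · rw [glueAt_of_ge h hu, glueAt_of_ge h hv]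
      exact hψ.strictMono huv
  locally_affine := by
    obtain ⟨S, hS, hSd, hSl⟩ := hφ.locally_affine
    obtain ⟨R, hR, hRd, hRl⟩ := hψ.locally_affine
    refine ⟨insert s (S ∪ R), (hS.union hR).insert s, ?_, fun t ht => ?_⟩
    · rintro r (rfl | hr | hr)
      exacts [hs, hSd r hr, hRd r hr]
    · simp only [mem_insert_iff, mem_union, not_or] at ht
      rcases lt_or_gt_of_ne ht.1 with hts | hts
      · obtain ⟨k, c, hkc⟩ := hSl t ht.2.1
        refine ⟨k, c, ?_⟩
        filter_upwards [hkc, eventually_lt_nhds hts] with u hu hus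
        rw [glueAt_of_le hus.le, hu]
      · obtain ⟨k, c, hkc⟩ := hRl t ht.2.2
        refine ⟨k, c, ?_⟩
        filter_upwards [hkc, eventually_gt_nhds hts] with u hu hus
        rw [glueAt_of_ge h hus.le, hu]

/-- Any two nondegenerate compact intervals with dyadic end points are related by a dyadic piecewise
linear map. Two slopes suffice: if `p` and `q` are the lengths of the intervals and
`2 ^ n * q ≤ p < 2 ^ (n + 1) * q`, they are `2 ^ (-n)` and `2 ^ (-(n + 1))`, and the first one is used
on an initial segment of length `2 ^ (n + 1) * q - p`. -/
theorem exists_isDyadicPL {a b c d : ℝ} (ha : IsDyadic a) (hb : IsDyadic b) (hc : IsDyadic c)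
    (hd : IsDyadic d) (hab : a < b) (hcd : c < d) :
    ∃ φ, IsDyadicPL φ ∧ φ a = c ∧ φ b = d := by
  have hp : 0 < b - a := sub_pos.2 hab
  have hq : 0 < d - c := sub_pos.2 hcd
  obtain ⟨n, hn1, hn2⟩ := exists_mem_Ico_zpow (div_pos hp hq) (one_lt_two (α := ℝ))
  rw [le_div_iff₀ hq] at hn1
  rw [div_lt_iff₀ hq] at hn2
  have hpos : (0 : ℝ) < 2 ^ n := by positivity
  have hsucc : (2 : ℝ) ^ (n + 1) = 2 ^ n * 2 := zpow_add_one₀ two_ne_zero n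
  have hinv : (2 : ℝ) ^ (-n) = (2 ^ n)⁻¹ := zpow_neg _ _
  have hinv' : (2 : ℝ) ^ (-(n + 1)) = (2 ^ n * 2)⁻¹ := by rw [zpow_neg, hsucc]
  set s := a + (2 ^ (n + 1) * (d - c) - (b - a)) with hs
  have has : a ≤ s := by rw [hs]; linarith
  have hsb : s ≤ b := by rw [hs, hsucc]; linarith
  have hsd : IsDyadic s := ha.add (((hd.sub hc).zpow_mul _).sub (hb.sub ha))
  have hglue : (2 : ℝ) ^ (-n) * s + (c - 2 ^ (-n) * a) =
      2 ^ (-(n + 1)) * s + (d - 2 ^ (-(n + 1)) * b) := by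
    rw [hs, hsucc, hinv, hinv']
    field_simp
    ring
  refine ⟨_, (isDyadicPL_affine (-n) (c - 2 ^ (-n) * a)).glue
    (isDyadicPL_affine (-(n + 1)) (d - 2 ^ (-(n + 1)) * b)) hsd hglue, ?_, ?_⟩
  · rw [glueAt_of_le has]
    ring
  · rw [glueAt_of_ge hglue hsb]
    ring

/-- A dyadic piecewise linear map can be modified inside a dyadic interval so as to take prescribed
values at two interior points. -/
theorem IsDyadicPL.exists_modify {φ : ℝ → ℝ} (hφ : IsDyadicPL φ) {a a' b' b c c' d' d : ℝ}
    (ha : IsDyadic a) (ha' : IsDyadic a') (hb' : IsDyadic b') (hb : IsDyadic b)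
    (hc : IsDyadic c) (hc' : IsDyadic c') (hd' : IsDyadic d') (hd : IsDyadic d)
    (h1 : a < a') (h2 : a' < b') (h3 : b' < b) (h1' : c < c') (h2' : c' < d') (h3' : d' < d)
    (hφa : φ a = c) (hφb : φ b = d) :
    ∃ ψ, IsDyadicPL ψ ∧ ψ a' = c' ∧ ψ b' = d' ∧ ∀ t ∉ Ioo a b, ψ t = φ t := by
  obtain ⟨φ₁, hφ₁, e₁, e₁'⟩ := exists_isDyadicPL ha ha' hc hc' h1 h1'
  obtain ⟨φ₂, hφ₂, e₂, e₂'⟩ := exists_isDyadicPL ha' hb' hc' hd' h2 h2'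
  obtain ⟨φ₃, hφ₃, e₃, e₃'⟩ := exists_isDyadicPL hb' hb hd' hd h3 h3'
  have g₄ : φ₃ b = φ b := by rw [e₃', hφb]
  have g₃ : φ₂ b' = glueAt b φ₃ φ b' := by rw [glueAt_of_le h3.le, e₂', e₃]
  have g₂ : φ₁ a' = glueAt b' φ₂ (glueAt b φ₃ φ) a' := by rw [glueAt_of_le h2.le, e₁', e₂]
  have g₁ : φ a = glueAt a' φ₁ (glueAt b' φ₂ (glueAt b φ₃ φ)) a := by rw [glueAt_of_le h1.le, hφa, e₁]
  refine ⟨_, hφ.glue (hφ₁.glue (hφ₂.glue (hφ₃.glue hφ hb g₄) hb' g₃) ha' g₂) ha g₁, ?_, ?_,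
    fun t ht => ?_⟩
  · rw [glueAt_of_ge g₁ h1.le, glueAt_of_le le_rfl, e₁']
  · rw [glueAt_of_ge g₁ (h1.trans h2).le, glueAt_of_ge g₂ h2.le, glueAt_of_le le_rfl, e₂']
  · rcases le_or_gt t a with hta | hta
    · rw [glueAt_of_le hta]
    · have hbt : b ≤ t := by
        by_contra hlt
        exact ht ⟨hta, not_le.1 hlt⟩
      rw [glueAt_of_ge g₁ hta.le, glueAt_of_ge g₂ (by linarith), glueAt_of_ge g₃ (by linarith),
        glueAt_of_ge g₄ hbt]

/-! ### The open interval -/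

theorem IsDyadicPL.exists_mem_thompsonF {φ : ℝ → ℝ} (hφ : IsDyadicPL φ) (h0 : φ 0 = 0)
    (h1 : φ 1 = 1) : ∃ f ∈ thompsonF, ∀ t : UnitOpenInterval, (f t : ℝ) = φ t := by
  let F : UnitOpenInterval → UnitOpenInterval := fun t => ⟨φ t, by
    have h := hφ.strictMono t.2.1
    rwa [h0] at h, by
    have h := hφ.strictMono t.2.2
    rwa [h1] at h⟩
  have hF : StrictMono F := fun s t hst => hφ.strictMono hst
  have hsurj : Function.Surjective F := by
    intro y
    obtain ⟨t, ht, hty⟩ := intermediate_value_Ioo zero_le_one hφ.continuous.continuousOn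
      (show (y : ℝ) ∈ Ioo (φ 0) (φ 1) by rw [h0, h1]; exact y.2)
    exact ⟨⟨t, ht⟩, Subtype.ext hty⟩
  refine ⟨(hF.orderIsoOfSurjective F hsurj).toHomeomorph, ?_, fun t => rfl⟩
  obtain ⟨S, hS, hSd, hSl⟩ := hφ.locally_affine
  refine ⟨S, hS, hSd, fun t ht => ?_⟩
  obtain ⟨k, c, hkc⟩ := hSl t ht
  exact ⟨k, c, continuous_subtype_val.continuousAt.eventually hkc⟩

theorem exists_seq_isDyadic_strictMono {l x : ℝ} (hl : IsDyadic l) (hlx : l < x) :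
    ∃ a : ℕ → ℝ, a 0 = l ∧ StrictMono a ∧ (∀ n, IsDyadic (a n)) ∧ (∀ n, a n < x) ∧
      Tendsto a atTop (𝓝 x) := by
  obtain ⟨u, hu, hux, hlim⟩ := exists_seq_strictMono_tendsto' hlx
  choose v hv using fun n => exists_isDyadic_btwn (hu (Nat.lt_succ_self n))
  refine ⟨fun n => Nat.casesOn n l v, rfl, strictMono_nat_of_lt_succ ?_, ?_, ?_, ?_⟩
  · rintro (_ | n)
    · exact (hux 0).1.trans (hv 0).2.1
    · exact (hv n).2.2.trans (hv (n + 1)).2.1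
  · rintro (_ | n)
    exacts [hl, (hv n).1]
  · rintro (_ | n)
    exacts [hlx, (hv n).2.2.trans (hux _).2]
  · rw [← tendsto_add_atTop_iff_nat 1]
    exact tendsto_of_tendsto_of_tendsto_of_le_of_le hlim ((tendsto_add_atTop_iff_nat 1).2 hlim)
      (fun n => (hv n).2.1.le) (fun n => (hv n).2.2.le)

/-- The closed dyadic intervals `[a n, b n]` are nested neighbourhoods of `x` that shrink to `x`,
the first one being `[0,1]`. -/
structure IsDyadicNest (a b : ℕ → ℝ) (x : ℝ) : Prop where
  left_zero : a 0 = 0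
  right_zero : b 0 = 1
  left_strictMono : StrictMono a
  right_strictAnti : StrictAnti b
  left_isDyadic : ∀ n, IsDyadic (a n)
  right_isDyadic : ∀ n, IsDyadic (b n)
  left_lt : ∀ n, a n < x
  lt_right : ∀ n, x < b n
  left_tendsto : Tendsto a atTop (𝓝 x)
  right_tendsto : Tendsto b atTop (𝓝 x)

theorem exists_isDyadicNest (x : UnitOpenInterval) : ∃ a b, IsDyadicNest a b x := by
  obtain ⟨a, h1, h2, h3, h4, h5⟩ :=
    exists_seq_isDyadic_strictMono (by simpa using IsDyadic.intCast 0) x.2.1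
  obtain ⟨b, h1', h2', h3', h4', h5'⟩ :=
    exists_seq_isDyadic_strictMono (by simpa using IsDyadic.intCast (-1)) (neg_lt_neg x.2.2)
  exact ⟨a, fun n => -b n, h1, by simp [h1'], h2, h2'.neg, h3, fun n => (h3' n).neg, h4,
    fun n => lt_neg_of_lt_neg (h4' n), h5, by simpa using h5'.neg⟩

theorem IsDyadicNest.hasAntitoneBasis {a b : ℕ → ℝ} {x : UnitOpenInterval}
    (h : IsDyadicNest a b x) :
    (𝓝 x).HasAntitoneBasis fun n => {z : UnitOpenInterval | (z : ℝ) ∈ Icc (a n) (b n)} := by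
  have hR : (𝓝 (x : ℝ)).HasAntitoneBasis fun n => Icc (a n) (b n) := by
    refine ⟨⟨fun V => ⟨fun hV => ?_, ?_⟩⟩, fun m n hmn =>
      Icc_subset_Icc (h.left_strictMono.monotone hmn) (h.right_strictAnti.antitone hmn)⟩
    · obtain ⟨l, u, hlu, hsub⟩ := mem_nhds_iff_exists_Ioo_subset.1 hV
      obtain ⟨n, hn1, hn2⟩ := ((h.left_tendsto.eventually_const_lt hlu.1).and
        (h.right_tendsto.eventually_lt_const hlu.2)).exists
      exact ⟨n, trivial, fun z hz => hsub ⟨hn1.trans_le hz.1, hz.2.trans_lt hn2⟩⟩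
    · rintro ⟨n, -, hn⟩
      exact mem_of_superset (Icc_mem_nhds (h.left_lt n) (h.lt_right n)) hn
  rw [nhds_subtype]
  exact hR.comap _

/-- Dyadic piecewise linear maps carrying one nest of intervals to another, each obtained by
modifying the previous one inside the corresponding interval. -/
theorem IsDyadicNest.exists_seq_isDyadicPL {a b c d : ℕ → ℝ} {x y : ℝ} (h : IsDyadicNest a b x)
    (h' : IsDyadicNest c d y) :
    ∃ φ : ℕ → ℝ → ℝ, (∀ n, IsDyadicPL (φ n) ∧ φ n (a n) = c n ∧ φ n (b n) = d n) ∧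
      ∀ n, ∀ t ∉ Ioo (a n) (b n), φ (n + 1) t = φ n t := by
  have step : ∀ n (φ : {φ : ℝ → ℝ // IsDyadicPL φ ∧ φ (a n) = c n ∧ φ (b n) = d n}),
      ∃ ψ : {φ : ℝ → ℝ // IsDyadicPL φ ∧ φ (a (n + 1)) = c (n + 1) ∧ φ (b (n + 1)) = d (n + 1)},
        ∀ t ∉ Ioo (a n) (b n), ψ.1 t = φ.1 t := by
    rintro n ⟨φ, hφ, ha, hb⟩
    obtain ⟨ψ, h1, h2, h3, h4⟩ := hφ.exists_modify (h.left_isDyadic n) (h.left_isDyadic (n + 1))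
      (h.right_isDyadic (n + 1)) (h.right_isDyadic n) (h'.left_isDyadic n)
      (h'.left_isDyadic (n + 1)) (h'.right_isDyadic (n + 1)) (h'.right_isDyadic n)
      (h.left_strictMono n.lt_succ_self) ((h.left_lt _).trans (h.lt_right _))
      (h.right_strictAnti n.lt_succ_self) (h'.left_strictMono n.lt_succ_self)
      ((h'.left_lt _).trans (h'.lt_right _)) (h'.right_strictAnti n.lt_succ_self) ha hb
    exact ⟨⟨ψ, h1, h2, h3⟩, h4⟩
  choose F hF using step
  let Φ : ∀ n, {φ : ℝ → ℝ // IsDyadicPL φ ∧ φ (a n) = c n ∧ φ (b n) = d n} := fun n =>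
    Nat.rec ⟨fun t => t, isDyadicPL_id, by rw [h.left_zero, h'.left_zero],
      by rw [h.right_zero, h'.right_zero]⟩ F n
  exact ⟨fun n => (Φ n).1, fun n => (Φ n).2, fun n => hF n (Φ n)⟩

theorem exists_agreesAwayFrom_thompsonF (x y : UnitOpenInterval) :
    ∃ f : UnitOpenInterval ≃ₜ UnitOpenInterval, f x = y ∧ AgreesAwayFrom thompsonF f x := by
  obtain ⟨a, b, h⟩ := exists_isDyadicNest x
  obtain ⟨c, d, h'⟩ := exists_isDyadicNest y
  obtain ⟨φ, hφ, hsucc⟩ := h.exists_seq_isDyadicPL h'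
  have h01 : ∀ n, φ n 0 = 0 ∧ φ n 1 = 1 := by
    intro n
    induction n with
    | zero =>
      obtain ⟨-, h1, h2⟩ := hφ 0
      rw [h.left_zero, h'.left_zero] at h1
      rw [h.right_zero, h'.right_zero] at h2
      exact ⟨h1, h2⟩
    | succ n ih =>
      have h1 := h.left_strictMono.monotone n.zero_le
      have h2 := h.right_strictAnti.antitone n.zero_le
      rw [h.left_zero] at h1
      rw [h.right_zero] at h2
      rw [hsucc n 0 fun h => h1.not_gt h.1, hsucc n 1 fun h => h2.not_gt h.2]
      exact ih
  choose g hg hgφ using fun n => (hφ n).1.exists_mem_thompsonF (h01 n).1 (h01 n).2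
  have hnest : NestedHomeos (fun n => {z : UnitOpenInterval | (z : ℝ) ∈ Icc (a n) (b n)})
      (fun n => {z : UnitOpenInterval | (z : ℝ) ∈ Icc (c n) (d n)}) g x y :=
    { basis_left := h.hasAntitoneBasis
      basis_right := h'.hasAntitoneBasis
      isClosed_left := fun n => isClosed_Icc.preimage continuous_subtype_val
      isClosed_right := fun n => isClosed_Icc.preimage continuous_subtype_val
      mem_iff := fun n z => by
        obtain ⟨h1, h2, h3⟩ := hφ n
        rw [mem_ofPred_eq, mem_ofPred_eq, hgφ, ← h2, ← h3, mem_Icc, mem_Icc,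
          h1.strictMono.le_iff_le, h1.strictMono.le_iff_le]
      eqOn_succ := fun n z hz => Subtype.ext (by
        rw [hgφ, hgφ]
        exact hsucc n z fun hz' => hz (Ioo_subset_Icc_self hz')) }
  exact hnest.exists_homeomorph hg

/-- If `g ∈ F` fixes an irrational `x` and is `2 ^ k * t + c` near `x`, then `c` is dyadic and
`(1 - 2 ^ k) * x = c`, which forces `k = 0` and `c = 0`. -/
theorem pointStabilizer_thompsonF_eq {x : UnitOpenInterval} (hx : Irrational (x : ℝ)) :
    pointStabilizer thompsonF x = nbhdStabilizer thompsonF x := by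
  ext g
  constructor
  · rintro ⟨hg, hgx⟩
    refine ⟨hg, ?_⟩
    have hg' : IsThompsonF g := hg
    obtain ⟨S, hS, hSd, hSl⟩ := hg
    have hdq : ∀ t : ℝ, IsDyadic t → ∃ q : ℚ, (q : ℝ) = t := by
      rintro _ ⟨m, n, rfl⟩
      exact ⟨m / 2 ^ n, by push_cast; rfl⟩
    have hxS : (x : ℝ) ∉ S := fun h => by
      obtain ⟨q, hq⟩ := hdq _ (hSd _ h)
      exact hx ⟨q, hq⟩
    obtain ⟨k, c, hkc⟩ := hSl x hxS
    have hx1 := hkc.self_of_nhds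
    rw [hgx] at hx1
    obtain ⟨e, he, hball⟩ := Metric.eventually_nhds_iff.1 hkc
    obtain ⟨u, hud, hu1, hu2⟩ := exists_isDyadic_btwn (lt_min (a := (x : ℝ)) x.2.2
      (show (x : ℝ) < x + e by linarith))
    have huI : u ∈ Ioo (0 : ℝ) 1 := ⟨x.2.1.trans hu1, hu2.trans_le (min_le_left _ _)⟩
    have hue := @hball ⟨u, huI⟩ (by
      rw [Subtype.dist_eq, Real.dist_eq, abs_of_pos (by linarith)]
      linarith [hu2.trans_le (min_le_right _ _)])
    have hcd : IsDyadic c := by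
      have h1 := (hg'.map_isDyadic ⟨u, huI⟩ hud).sub (hud.zpow_mul k)
      rwa [hue, add_sub_cancel_left] at h1
    have hk : (2 : ℝ) ^ k = 1 := by
      by_contra hne
      have hne' : (1 : ℝ) - 2 ^ k ≠ 0 := sub_ne_zero.2 (Ne.symm hne)
      obtain ⟨q, rfl⟩ := hdq c hcd
      refine hx ⟨q / (1 - 2 ^ k), ?_⟩
      push_cast
      rw [div_eq_iff hne']
      linarith
    rw [hk, one_mul, left_eq_add] at hx1
    rw [hk, hx1] at hkc
    obtain ⟨U, hU, hUo, hxU⟩ := eventually_nhds_iff.1 hkc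
    exact ⟨U, hUo, hxU, fun z hz => Subtype.ext (by simpa using hU z hz)⟩
  · rintro ⟨hg, U, -, hxU, hfix⟩
    exact ⟨hg, hfix x hxU⟩

/-! ### The circle -/

/-- The inclusion of `(0,1)` into the circle `ℝ / ℤ`. -/
def intervalToCircle (t : UnitOpenInterval) : UnitAddCircle := ((t : ℝ) : UnitAddCircle)

theorem isEmbedding_intervalToCircle : IsEmbedding intervalToCircle := by
  have h := (AddCircle.openPartialHomeomorphCoe (1 : ℝ) 0).isOpenEmbedding_restrict.isEmbedding
  have hI : Ioo (0 : ℝ) 1 = Ioo (0 : ℝ) (0 + 1) := by rw [zero_add]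
  exact h.comp (Homeomorph.setCongr hI).isEmbedding

theorem range_intervalToCircle : range intervalToCircle = {0}ᶜ := by
  have h := (AddCircle.openPartialHomeomorphCoe (1 : ℝ) 0).image_source_eq_target
  rw [AddCircle.openPartialHomeomorphCoe_source, AddCircle.openPartialHomeomorphCoe_target,
    zero_add, image_eq_range] at h
  exact h

/-- The circle is the one-point compactification of `(0,1)`, the point at infinity being `0`. -/
noncomputable def onePointIntervalHomeo : OnePoint UnitOpenInterval ≃ₜ UnitAddCircle :=
  OnePoint.equivOfIsEmbeddingOfRangeEq 0 intervalToCircle isEmbedding_intervalToCircle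
    range_intervalToCircle

/-- The extension of a homeomorphism of `(0,1)` to the circle by `0 ↦ 0`. -/
noncomputable def extendToCircle (f : UnitOpenInterval ≃ₜ UnitOpenInterval) :
    UnitAddCircle ≃ₜ UnitAddCircle :=
  onePointIntervalHomeo.symm.trans (f.onePointCongr.trans onePointIntervalHomeo)

theorem extendToCircle_zero (f : UnitOpenInterval ≃ₜ UnitOpenInterval) :
    extendToCircle f 0 = 0 := by
  have h : onePointIntervalHomeo.symm 0 = OnePoint.infty :=
    (Homeomorph.symm_apply_eq _).2 rfl
  change onePointIntervalHomeo (f.onePointCongr (onePointIntervalHomeo.symm 0)) = 0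
  rw [h]
  rfl

theorem extendToCircle_coe (f : UnitOpenInterval ≃ₜ UnitOpenInterval) (t : UnitOpenInterval) :
    extendToCircle f (intervalToCircle t) = intervalToCircle (f t) := by
  have h : onePointIntervalHomeo.symm (intervalToCircle t) = (t : OnePoint UnitOpenInterval) :=
    (Homeomorph.symm_apply_eq _).2 rfl
  change onePointIntervalHomeo (f.onePointCongr (onePointIntervalHomeo.symm _)) = _
  rw [h]
  rfl

theorem eq_zero_or_exists_intervalToCircle (p : UnitAddCircle) :
    p = 0 ∨ ∃ t, intervalToCircle t = p := by
  by_cases hp : p = 0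
  · exact Or.inl hp
  · exact Or.inr (by rwa [← mem_range, range_intervalToCircle])

theorem extendToCircle_mem_thompsonT {f : UnitOpenInterval ≃ₜ UnitOpenInterval}
    (hf : f ∈ thompsonF) : extendToCircle f ∈ thompsonT := by
  have hf' : IsThompsonF f := hf
  obtain ⟨S, hS, hSd, hSl⟩ := hf
  have h0 : IsDyadic 0 := by simpa using IsDyadic.intCast 0
  refine ⟨fun p hp => ?_, insert 0 ((fun t : ℝ => (t : UnitAddCircle)) '' S),
    (hS.image _).insert 0, ?_, fun t ht => ?_⟩
  · obtain rfl | ⟨t, rfl⟩ := eq_zero_or_exists_intervalToCircle p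
    · rwa [extendToCircle_zero]
    · rw [extendToCircle_coe]
      exact isDyadicPoint_coe.2 (hf'.map_isDyadic t (isDyadicPoint_coe.1 hp))
  · rintro _ (rfl | ⟨s, hs, rfl⟩)
    exacts [⟨0, h0, rfl⟩, ⟨s, hSd s hs, rfl⟩]
  · have ht0 : (t : UnitAddCircle) ≠ 0 := fun h => ht (Or.inl h)
    obtain ⟨s, hs⟩ := (eq_zero_or_exists_intervalToCircle t).resolve_left ht0
    have hsS : (s : ℝ) ∉ S := fun h => ht (Or.inr ⟨s, h, hs⟩)
    obtain ⟨k, c, hkc⟩ := hSl s hsS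
    obtain ⟨n, hn⟩ := circle_coe_eq_iff.1 hs
    -- `u ↦ u + n` translates a neighbourhood of `t` into `(0,1)`
    have htn : t + n = s := by rw [hn]; ring
    have hcont : Continuous fun u : ℝ => u + n := by fun_prop
    have hev : ∀ᶠ v : ℝ in 𝓝 (s : ℝ), ∃ hv : v ∈ Ioo (0 : ℝ) 1, (f ⟨v, hv⟩ : ℝ) = 2 ^ k * v + c := by
      rw [← map_nhds_subtype_coe_eq_nhds s.2 (isOpen_Ioo.mem_nhds s.2), eventually_map]
      filter_upwards [hkc] with v hv
      exact ⟨v.2, hv⟩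
    rw [← htn] at hev
    refine ⟨k, 2 ^ k * n + c, ?_⟩
    filter_upwards [hcont.continuousAt.eventually hev] with u ⟨hu, hfu⟩
    have hcoe : (u : UnitAddCircle) = intervalToCircle ⟨u + n, hu⟩ :=
      circle_coe_eq_iff.2 ⟨-n, by push_cast; ring⟩
    rw [hcoe, extendToCircle_coe, intervalToCircle, hfu]
    congr 1
    ring

theorem AgreesAwayFrom.extendToCircle {f : UnitOpenInterval ≃ₜ UnitOpenInterval}
    {x : UnitOpenInterval} (hf : AgreesAwayFrom thompsonF f x) :
    AgreesAwayFrom thompsonT (extendToCircle f) (intervalToCircle x) := by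
  intro U hU
  obtain ⟨g, hg, hfg⟩ := hf _
    (isEmbedding_intervalToCircle.continuous.continuousAt.preimage_mem_nhds hU)
  refine ⟨_, extendToCircle_mem_thompsonT hg, fun p hp => ?_⟩
  obtain rfl | ⟨t, rfl⟩ := eq_zero_or_exists_intervalToCircle p
  · rw [extendToCircle_zero, extendToCircle_zero]
  · rw [extendToCircle_coe, extendToCircle_coe, hfg hp]

/-- A rotation by one half moves `0` into the image of `(0,1)`. -/
theorem exists_mem_thompsonT_apply_eq (p : UnitAddCircle) :
    ∃ r ∈ thompsonT, ∃ t, r p = intervalToCircle t := by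
  obtain rfl | ⟨t, rfl⟩ := eq_zero_or_exists_intervalToCircle p
  · have hhalf : IsDyadic (1 / 2) := ⟨1, 1, by norm_num⟩
    refine ⟨Homeomorph.addRight ((1 / 2 : ℝ) : UnitAddCircle), ⟨?_, ∅, finite_empty, by simp,
      fun t _ => ⟨0, 1 / 2, Eventually.of_forall fun u => by simp⟩⟩,
      ⟨1 / 2, by norm_num, by norm_num⟩, by simp [intervalToCircle]⟩
    rintro _ ⟨t, ht, rfl⟩
    exact ⟨t + 1 / 2, ht.add hhalf, by simp⟩
  · exact ⟨1, thompsonT.one_mem, t, rfl⟩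

theorem exists_agreesAwayFrom_thompsonT (x y : UnitAddCircle) :
    ∃ f : UnitAddCircle ≃ₜ UnitAddCircle, f x = y ∧ AgreesAwayFrom thompsonT f x := by
  obtain ⟨r, hr, s, hrs⟩ := exists_mem_thompsonT_apply_eq x
  obtain ⟨q, hq, t, hqt⟩ := exists_mem_thompsonT_apply_eq y
  obtain ⟨f, hfs, hf⟩ := exists_agreesAwayFrom_thompsonF s t
  have h1 : (r.trans (extendToCircle f)) x = q y := by
    rw [Homeomorph.trans_apply, hrs, extendToCircle_coe, hfs, hqt]
  refine ⟨(r.trans (extendToCircle f)).trans q.symm, ?_, ?_⟩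
  · rw [Homeomorph.trans_apply, h1, q.symm_apply_apply]
  · refine ((AgreesAwayFrom.of_mem hr x).trans ?_).trans (.of_mem (thompsonT.inv_mem hq) _)
    rw [hrs]
    exact hf.extendToCircle

/-! ### The neighbourhood stabilisers -/

theorem mainTheorem9 :
    (∀ x y : UnitOpenInterval, ∃ f : UnitOpenInterval ≃ₜ UnitOpenInterval,
      (nbhdStabilizer thompsonF x).map (MulAut.conj f).toMonoidHom = nbhdStabilizer thompsonF y) ∧
    (∀ x y : UnitAddCircle, ∃ f : UnitAddCircle ≃ₜ UnitAddCircle,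
      (nbhdStabilizer thompsonT x).map (MulAut.conj f).toMonoidHom = nbhdStabilizer thompsonT y) ∧
    (∀ x y : CantorSpace, ∃ f : CantorSpace ≃ₜ CantorSpace,
      (nbhdStabilizer thompsonV x).map (MulAut.conj f).toMonoidHom = nbhdStabilizer thompsonV y) ∧
    (∀ x y : UnitOpenInterval, Irrational (x : ℝ) → Irrational (y : ℝ) →
      Nonempty (pointStabilizer thompsonF x ≃* pointStabilizer thompsonF y)) := by
  refine ⟨fun x y => ?_, fun x y => ?_, fun x y => ?_, fun x y hx hy => ?_⟩
  · obtain ⟨f, rfl, hf⟩ := exists_agreesAwayFrom_thompsonF x y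
    exact ⟨f, hf.map_conj_nbhdStabilizer⟩
  · obtain ⟨f, rfl, hf⟩ := exists_agreesAwayFrom_thompsonT x y
    exact ⟨f, hf.map_conj_nbhdStabilizer⟩
  · have h := (agreesAwayFrom_prefixSwapHomeo x y).map_conj_nbhdStabilizer
    rw [prefixSwapHomeo_self] at h
    exact ⟨_, h⟩
  · rw [pointStabilizer_thompsonF_eq hx, pointStabilizer_thompsonF_eq hy]
    obtain ⟨f, rfl, hf⟩ := exists_agreesAwayFrom_thompsonF x y
    rw [← hf.map_conj_nbhdStabilizer]
    exact ⟨Subgroup.equivMapOfInjective _ _ (MulAut.conj f).injective⟩
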